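/- Let $d\ge 1$. For a finite (positive) Borel measure $\mu$ on $\mathbb R^d$ put $F_\mu(r,y)=\mu(\{x:|x-y|\le r\})$, and for $F:\mathbb R\to\mathbb R$ define recursively $\Delta_0F(r)=F(r)-F(r/2)$ and $\Delta_{k+1}F(r)=\Delta_kF(r)-2^{k+1}\Delta_kF(r/2)$. For $\alpha>0$ and $1\le p,q\le\infty$ set, with $k=\lceil\alpha+d-1\rceil$ and $(\Delta_k)_r$ acting in the variable $r$, $$\|\mu\|_{\mathrm{SBE}^{\alpha,p}_q}=\Big\|\,\big\|r^{-\alpha-d}(\Delta_k)_rF_\mu(r,y)\big\|_{L^p((0,\infty),\,dr/r)}\Big\|_{L^q(\mathbb R^d,\,dy)},$$ and write $\mu\in\mathrm{SBE}^{\alpha,p}_q$ if $\mu$ is compactly supported and this quantity is finite. Let $\chi\in C^\infty(\mathbb R^d;\mathbb R)$ be radial, with $\chi(\xi)=1$ for $|\xi|\le1$ and $\chi(\xi)=0$ for $|\xi|\ge2$. For a tempered distribution $T$ let $\dot\Delta_jT$ $(j\in\mathbb Z)$ be the Fourier multiplier with symbol $\chi(2^{-j}\xi)-\chi(2^{1-j}\xi)$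 applied to $T$, let $S_0T$ be the Fourier multiplier with symbol $\chi$ applied to $T$, and set $$\|T\|_{\dot B^{\alpha}_{q,\infty}}=\sup_{j\in\mathbb Z}2^{j\alpha}\|\dot\Delta_jT\|_{L^q},\qquad \|T\|_{B^{\alpha}_{q,\infty}}=\max\Big(\|S_0T\|_{L^q},\ \sup_{j\ge1}2^{j\alpha}\|\dot\Delta_jT\|_{L^q}\Big),$$ where the $L^q$ norm of a distribution is $\infty$ if it is not represented by a function in $L^q$. The distribution $T$ belongs to the Besov space $B^\alpha_{q,\infty}$ if $\|T\|_{B^\alpha_{q,\infty}}<\infty$ for every such $\chi$. **Theorem.** Let $\alpha>0$, $1\le p<\infty$ and $1\le q\le\infty$. If $\mu\in\mathrm{SBE}^{\alpha,p}_q$, then $\mu\in B^\alpha_{q,\infty}$. Moreover, for every $\chi$ as above: 1. there is a constant $C=C(d,\alpha,p,q,\chi)$ such that for every $\mu\in\mathrm{SBE}^{\alpha,p}_q$ $$\|\mu\|_{\dot B^{\alpha}_{q,\infty}}\le C\,\|\mu\|_{\mathrm{SBE}^{\alpha,p}_q};$$ 2. for every $R$ there is a constant $C_R=C_R(d,\alpha,p,q,\chi,R)$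 such that for every $\mu\in\mathrm{SBE}^{\alpha,p}_q$ that is carried by some closed ball of radius $R$ (with arbitrary centre) $$\|\mu\|_{B^{\alpha}_{q,\infty}}\le C_R\,\|\mu\|_{\mathrm{SBE}^{\alpha,p}_q}.$$ -/

import Mathlib

open MeasureTheory
open scoped ENNReal NNReal SchwartzMap

noncomputable section

namespace SmallBall

/-- The Euclidean space of dimension `d`. -/
abbrev E (d : ℕ) : Type := EuclideanSpace ℝ (Fin d)

/-! ### Small ball estimates -/

/-- `F_μ(r, y) = μ {x : |x - y| ≤ r}`, written with the centre `y` first. -/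
def ballMass {d : ℕ} (μ : Measure (E d)) (y : E d) (r : ℝ) : ℝ :=
  μ.real {x : E d | ‖x - y‖ ≤ r}

/-- The iterated dyadic differences: `Δ_0 F(r) = F(r) - F(r/2)` and
`Δ_{k+1} F(r) = Δ_k F(r) - 2^{k+1} Δ_k F(r/2)`. -/
def dyadicDiff : ℕ → (ℝ → ℝ) → ℝ → ℝ
  | 0, F, r => F r - F (r / 2)
  | k + 1, F, r => dyadicDiff k F r - 2 ^ (k + 1) * dyadicDiff k F (r / 2)

/-- The measure `dr / r` on the open half-line `(0, ∞)`. -/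
def radialMeasure : Measure ℝ :=
  (volume.restrict (Set.Ioi (0 : ℝ))).withDensity fun r => ENNReal.ofReal r⁻¹

/-- The `SBE^{α,p}_q` norm: with `k = ⌈α + d - 1⌉`, the `L^q(dy)` norm of the `L^p(dr/r)` norm of
`r^{-α-d} (Δ_k)_r F_μ(r, y)`, with values in `[0, ∞]`. -/
def sbeNorm {d : ℕ} (α : ℝ) (p q : ℝ≥0∞) (μ : Measure (E d)) : ℝ≥0∞ :=
  eLpNorm
    (fun y : E d =>
      eLpNorm
        (fun r : ℝ => r ^ (-α - (d : ℝ)) * dyadicDiff ⌈α + (d : ℝ) - 1⌉₊ (ballMass μ y) r)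
        p radialMeasure)
    q volume

/-- The measure is carried by a compact set. -/
def IsCompactlySupported {d : ℕ} (μ : Measure (E d)) : Prop :=
  ∃ K : Set (E d), IsCompact K ∧ μ Kᶜ = 0

/-- A compactly supported finite measure whose `SBE^{α,p}_q` norm is finite. -/
def MemSBE {d : ℕ} (α : ℝ) (p q : ℝ≥0∞) (μ : Measure (E d)) [IsFiniteMeasure μ] : Prop :=
  IsCompactlySupported μ ∧ sbeNorm α p q μ < ∞

/-! ### Besov spaces of tempered distributions, by a Littlewood-Paley decomposition -/

/-- A radial smooth function, equal to `1` on the unit ball and to `0` off the ball of radius `2`.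
-/
structure IsLPCutoff {d : ℕ} (χ : E d → ℝ) : Prop where
  smooth : ContDiff ℝ (⊤ : ℕ∞) χ
  radial : ∀ ξ η : E d, ‖ξ‖ = ‖η‖ → χ ξ = χ η
  eq_one : ∀ ξ : E d, ‖ξ‖ ≤ 1 → χ ξ = 1
  eq_zero : ∀ ξ : E d, 2 ≤ ‖ξ‖ → χ ξ = 0

/-- The `L^p` norm of a tempered distribution: the `L^p` norm of the function that represents it,
and `∞` if there is no such function in `L^p`. -/
def distLpNorm {d : ℕ} (p : ℝ≥0∞) (T : 𝓢'(E d, ℂ)) : ℝ≥0∞ :=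
  ⨅ (f : E d → ℂ) (_ : MemLp f p volume) (_ : ∀ g : 𝓢(E d, ℂ), T g = ∫ x, g x * f x),
    eLpNorm f p volume

/-- The homogeneous Littlewood-Paley block of frequency `2^j`: the Fourier multiplier with symbol
`χ(2^{-j} ξ) - χ(2^{1-j} ξ)`. -/
def dyadicBlock {d : ℕ} (χ : E d → ℝ) (j : ℤ) (T : 𝓢'(E d, ℂ)) : 𝓢'(E d, ℂ) :=
  TemperedDistribution.fourierMultiplierCLM ℂ
    (fun ξ => ((χ ((2 : ℝ) ^ (-j) • ξ) - χ ((2 : ℝ) ^ (1 - j) • ξ) : ℝ) : ℂ)) T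

/-- The inhomogeneous Littlewood-Paley blocks: the multiplier with symbol `χ` for `j = 0`, which
gathers the low frequencies, and the block of frequency `2^j` for `j ≥ 1`. -/
def inhomBlock {d : ℕ} (χ : E d → ℝ) : ℕ → 𝓢'(E d, ℂ) → 𝓢'(E d, ℂ)
  | 0, T => TemperedDistribution.fourierMultiplierCLM ℂ (fun ξ => (χ ξ : ℂ)) T
  | j + 1, T => dyadicBlock χ ((j : ℤ) + 1) T

/-- The (inhomogeneous) Besov norm: the `ℓ^r` norm over `j ∈ ℕ` of `2^{js} ‖Δ_j T‖_{L^p}`. -/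
def besovNorm {d : ℕ} (χ : E d → ℝ) (s : ℝ) (p r : ℝ≥0∞) (T : 𝓢'(E d, ℂ)) : ℝ≥0∞ :=
  eLpNorm (fun j : ℕ => (2 : ℝ≥0∞) ^ ((j : ℝ) * s) * distLpNorm p (inhomBlock χ j T)) r
    Measure.count

/-- The homogeneous Besov seminorm: the `ℓ^r` norm over `j ∈ ℤ` of `2^{js} ‖Δ_j T‖_{L^p}`. -/
def homBesovNorm {d : ℕ} (χ : E d → ℝ) (s : ℝ) (p r : ℝ≥0∞) (T : 𝓢'(E d, ℂ)) : ℝ≥0∞ :=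
  eLpNorm (fun j : ℤ => (2 : ℝ≥0∞) ^ ((j : ℝ) * s) * distLpNorm p (dyadicBlock χ j T)) r
    Measure.count

/-- The Besov space `B^s_{p,r}`: the tempered distributions with a finite Besov norm, for every
choice of the Littlewood-Paley cutoff. -/
def MemBesov {d : ℕ} (s : ℝ) (p r : ℝ≥0∞) (T : 𝓢'(E d, ℂ)) : Prop :=
  ∀ χ : E d → ℝ, IsLPCutoff χ → besovNorm χ s p r T < ∞

end SmallBall

end

namespace SmallBall

open scoped FourierTransform RealInnerProductSpace

/-! A Gaussian is a superposition of indicators of balls: `exp (-c|x - v|²)` is the integral of `2cr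
exp (-cr²)` over `r ≥ |x - v|`. Since `Δ_k F(r) = ∑ a_i F(r/2^i)`, integrating `Δ_k F_μ(·, v)`
against this density gives `(G_c * μ)(v)`, where `G_c` is the combination of the Gaussians of
parameters `4^i c` with coefficients `a_i` (`integral_gaussSum_eq`). Hölder's inequality for `dr/r`
bounds it by `c^{-(α+d)/2}` times the inner `SBE` norm at `v` (`enorm_integral_gaussDensity_le`).

The Fourier transform of `G_c` is again a sum of Gaussians. Its slowest decaying term, `i = k + 1`,
has a nonzero coefficient, so the symbol has no zero with `|ξ|` above a multiple of `√c`
(`exists_gaussSymbol_ne_zero`). Take `c = (b 2^j)²` with `b` small: the Littlewood-Paley symbol at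
frequency `2^j` is then a smooth compactly supported function `h_j` times the symbol of `G_c`, and
the block is `G_c * μ` averaged against an integrable kernel (`distLpNorm_multiplier_le_gauss`). The
kernel has `L¹` norm proportional to `2^{jd}`, and `2^{jα} 2^{jd} (b 2^j)^{-(α+d)}` does not depend
on `j`; this is the homogeneous bound (`exists_dyadicBlock_le`).

The low frequencies are controlled by the total mass. For `μ` on a ball of radius `R`, some centres
`y` and radii `r` comparable to `max R 1` have the whole mass within `r` of `y` and none within
`r/2`, so that `Δ_k F_μ(r, y)` is the mass (`exists_mass_le_sbeNorm`). -/

/-! ### Dyadic differences and exponential sums. -/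

lemma exists_dyadicDiff_eq_sum (k : ℕ) : ∃ a : ℕ → ℝ, a 0 = 1 ∧ a (k + 1) ≠ 0 ∧
    ∀ F r, dyadicDiff k F r = ∑ i ∈ Finset.range (k + 2), a i * F (r / 2 ^ i) := by
  induction k with
  | zero =>
    refine ⟨fun i => if i = 0 then 1 else -1, by simp, by simp, fun F r => ?_⟩
    simp [dyadicDiff, Finset.sum_range_succ, sub_eq_add_neg]
  | succ k ih =>
    obtain ⟨a, ha0, ha1, ha⟩ := ih
    -- The coefficients are `a_i - 2^{k+1} a_{i-1}`. The old ones are cut off at `k + 2`, beyond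
    -- which nothing is known of them, so the last new one is `-2^{k+1} a_{k+1}`.
    refine ⟨fun i => (if i < k + 2 then a i else 0)
      - 2 ^ (k + 1) * (if i = 0 then 0 else a (i - 1)), by simp [ha0], by simp [ha1],
      fun F r => ?_⟩
    have h1 : ∑ i ∈ Finset.range (k + 3), (if i < k + 2 then a i else 0) * F (r / 2 ^ i)
        = ∑ i ∈ Finset.range (k + 2), a i * F (r / 2 ^ i) := by
      rw [Finset.sum_range_succ]
      simp only [lt_irrefl, if_false, zero_mul, add_zero]
      exact Finset.sum_congr rfl fun i hi => by simp [Finset.mem_range.1 hi]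
    have h2 : ∑ i ∈ Finset.range (k + 3), (if i = 0 then 0 else a (i - 1)) * F (r / 2 ^ i)
        = ∑ i ∈ Finset.range (k + 2), a i * F (r / 2 / 2 ^ i) := by
      rw [Finset.sum_range_succ']
      simp only [Nat.add_eq_zero_iff, one_ne_zero, and_false, if_false, if_true, zero_mul, add_zero,
        Nat.add_sub_cancel]
      exact Finset.sum_congr rfl fun i _ => by rw [pow_succ', div_div]
    simp only [sub_mul, Finset.sum_sub_distrib, mul_assoc, ← Finset.mul_sum]
    rw [h1, h2, dyadicDiff, ha, ha]

/-- The term `i = n` decays slowest: after multiplication by `exp (t / 4^n)` every other term tends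
to `0` and the sum tends to `a n`. -/
lemma exists_sum_exp_ne_zero (n : ℕ) (a : ℕ → ℝ) (ha : a n ≠ 0) :
    ∃ T : ℝ, 0 < T ∧ ∀ t, T ≤ t →
      ∑ i ∈ Finset.range (n + 1), a i * Real.exp (-t / 4 ^ i) ≠ 0 := by
  have key : Filter.Tendsto (fun t : ℝ => ∑ i ∈ Finset.range (n + 1),
      a i * Real.exp (-t / 4 ^ i + t / 4 ^ n)) Filter.atTop (nhds (a n)) := by
    have : a n = ∑ i ∈ Finset.range (n + 1), if i = n then a n else 0 := by simp
    rw [this]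
    refine tendsto_finsetSum _ fun i hi => ?_
    rcases eq_or_ne i n with rfl | hin
    · simp [neg_div]
    · have hlt : i < n := by have := Finset.mem_range.1 hi; omega
      have h4 : (0 : ℝ) < 1 / 4 ^ i - 1 / 4 ^ n := by
        rw [sub_pos]
        exact one_div_lt_one_div_of_lt (by positivity) (pow_lt_pow_right₀ (by norm_num) hlt)
      rw [if_neg hin]
      have h5 : Filter.Tendsto (fun t : ℝ => Real.exp (-t / 4 ^ i + t / 4 ^ n)) Filter.atTop
          (nhds 0) := by
        have : (fun t : ℝ => Real.exp (-t / 4 ^ i + t / 4 ^ n))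
            = fun t => Real.exp (-((1 / 4 ^ i - 1 / 4 ^ n) * t)) := by
          ext t; congr 1; ring
        rw [this]
        exact Real.tendsto_exp_neg_atTop_nhds_zero.comp (Filter.tendsto_id.const_mul_atTop h4)
      simpa using h5.const_mul (a i)
  obtain ⟨T, hT⟩ := Filter.eventually_atTop.1 (key.eventually_ne ha)
  refine ⟨max T 1, by positivity, fun t ht h0 => hT t (le_trans (le_max_left _ _) ht) ?_⟩
  have : ∑ i ∈ Finset.range (n + 1), a i * Real.exp (-t / 4 ^ i + t / 4 ^ n)
      = (∑ i ∈ Finset.range (n + 1), a i * Real.exp (-t / 4 ^ i)) * Real.exp (t / 4 ^ n) := by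
    rw [Finset.sum_mul]
    exact Finset.sum_congr rfl fun i _ => by rw [Real.exp_add, mul_assoc]
  rw [this, h0, zero_mul]

/-! ### Minkowski's inequality and the measure `dr / r`. -/

/-- Minkowski's integral inequality against a finite measure, with a uniform bound on the slices. -/
lemma eLpNorm_lintegral_le {X Y : Type*} [MeasurableSpace X] [MeasurableSpace Y]
    (ν : Measure X) [IsFiniteMeasure ν] (ρ : Measure Y) [SFinite ρ] {q : ℝ≥0∞} (hq : 1 ≤ q)
    (k : X → Y → ℝ≥0∞) (hk : Measurable (Function.uncurry k)) (M : ℝ≥0∞)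
    (hM : ∀ u, eLpNorm (k u) q ρ ≤ M) :
    eLpNorm (fun y => ∫⁻ u, k u y ∂ν) q ρ ≤ ν Set.univ * M := by
  have hk' : ∀ y, Measurable fun u => k u y := fun y => hk.comp measurable_prodMk_right
  rcases eq_or_ne q ∞ with rfl | hqt
  · have hae : ∀ᵐ y ∂ρ, ∀ᵐ u ∂ν, k u y ≤ M := by
      have hs : MeasurableSet {z : X × Y | k z.1 z.2 ≤ M} := measurableSet_le hk measurable_const
      refine (Measure.ae_ae_comm hs).1 (Filter.Eventually.of_forall fun u => ?_)
      have := hM u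
      rw [eLpNorm_exponent_top] at this
      filter_upwards [enorm_ae_le_eLpNormEssSup (k u) ρ] with y hy using hy.trans this
    rw [eLpNorm_exponent_top]
    refine essSup_le_of_ae_le _ ?_
    filter_upwards [hae] with y hy
    calc ‖∫⁻ u, k u y ∂ν‖ₑ ≤ ∫⁻ _, M ∂ν := lintegral_mono_ae hy
      _ = ν Set.univ * M := by rw [lintegral_const, mul_comm]
  · have hq0 : q ≠ 0 := (zero_lt_one.trans_le hq).ne'
    have hqr : 0 < q.toReal := ENNReal.toReal_pos hq0 hqt
    have hq1 : 1 ≤ q.toReal := by simpa using ENNReal.toReal_mono hqt hq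
    -- As `ν` is finite and the slices are uniformly bounded, Hölder against the constant `1`
    -- followed by Tonelli is enough.
    have h1 : ∀ y, (∫⁻ u, k u y ∂ν) ^ q.toReal
        ≤ (∫⁻ u, k u y ^ q.toReal ∂ν) * ν Set.univ ^ (q.toReal - 1) := by
      intro y
      have := eLpNorm_le_eLpNorm_mul_rpow_measure_univ (μ := ν) (f := fun u => k u y) hq
        (hk' y).aestronglyMeasurable
      rw [eLpNorm_one_eq_lintegral_enorm, eLpNorm_eq_lintegral_rpow_enorm_toReal hq0 hqt] at this
      simp only [enorm_eq_self, ENNReal.toReal_one, div_one] at this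
      calc _ ≤ _ := ENNReal.rpow_le_rpow this hqr.le
        _ = _ := by
          rw [ENNReal.mul_rpow_of_nonneg _ _ hqr.le, ← ENNReal.rpow_mul, ← ENNReal.rpow_mul,
            one_div, inv_mul_cancel₀ hqr.ne', ENNReal.rpow_one]
          congr 2
          field_simp
    have h2 : ∀ u, ∫⁻ y, k u y ^ q.toReal ∂ρ ≤ M ^ q.toReal := by
      intro u
      have := ENNReal.rpow_le_rpow (hM u) hqr.le
      rw [eLpNorm_eq_lintegral_rpow_enorm_toReal hq0 hqt, ← ENNReal.rpow_mul, one_div,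
        inv_mul_cancel₀ hqr.ne', ENNReal.rpow_one] at this
      simpa using this
    rw [eLpNorm_eq_lintegral_rpow_enorm_toReal hq0 hqt]
    simp only [enorm_eq_self]
    rw [one_div, ENNReal.rpow_inv_le_iff hqr]
    calc ∫⁻ y, (∫⁻ u, k u y ∂ν) ^ q.toReal ∂ρ
        ≤ ∫⁻ y, (∫⁻ u, k u y ^ q.toReal ∂ν) * ν Set.univ ^ (q.toReal - 1) ∂ρ := lintegral_mono h1
      _ = (∫⁻ u, ∫⁻ y, k u y ^ q.toReal ∂ρ ∂ν) * ν Set.univ ^ (q.toReal - 1) := by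
          have hm : Measurable (Function.uncurry fun (y : Y) (u : X) => k u y ^ q.toReal) :=
            (hk.comp measurable_swap).pow_const _
          rw [lintegral_mul_const _ hm.lintegral_prod_right,
            lintegral_lintegral_swap hm.aemeasurable]
      _ ≤ (∫⁻ _, M ^ q.toReal ∂ν) * ν Set.univ ^ (q.toReal - 1) := by gcongr; exact h2 _
      _ = (ν Set.univ * M) ^ q.toReal := by
          rw [lintegral_const, ENNReal.mul_rpow_of_nonneg _ _ hqr.le, mul_assoc, mul_comm]
          congr 1
          nth_rw 1 [← ENNReal.rpow_one (ν Set.univ)]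
          rw [← ENNReal.rpow_add_of_nonneg _ _ zero_le_one (by linarith)]
          congr 1; ring

lemma lintegral_radialMeasure (f : ℝ → ℝ≥0∞) :
    ∫⁻ r, f r ∂radialMeasure = ∫⁻ r in Set.Ioi 0, ENNReal.ofReal r⁻¹ * f r := by
  rw [radialMeasure, lintegral_withDensity_eq_lintegral_mul_non_measurable₀]
  · rfl
  · fun_prop
  · exact Filter.Eventually.of_forall fun _ => ENNReal.ofReal_lt_top

lemma ae_radialMeasure_pos : ∀ᵐ r ∂radialMeasure, 0 < r :=
  (withDensity_absolutelyContinuous _ _).ae_le (ae_restrict_mem measurableSet_Ioi)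

/-- Extended by zero to the line, the integrand obeys the change of variables for Lebesgue measure,
whose factor `b⁻¹` cancels against that of `r⁻¹`. -/
lemma measurePreserving_mul_radialMeasure {b : ℝ} (hb : 0 < b) :
    MeasurePreserving (fun r => b * r) radialMeasure radialMeasure := by
  refine ⟨by fun_prop, Measure.ext_of_lintegral _ fun f hf => ?_⟩
  rw [lintegral_map hf (by fun_prop), lintegral_radialMeasure, lintegral_radialMeasure]
  set g : ℝ → ℝ≥0∞ := (Set.Ioi (0 : ℝ)).indicator fun r => ENNReal.ofReal r⁻¹ * f r with hg
  have hgm : Measurable g := Measurable.indicator (by fun_prop) measurableSet_Ioi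
  have h1 : ∫⁻ r, g (b * r) = ENNReal.ofReal b⁻¹ * ∫⁻ r, g r := by
    rw [← lintegral_map (f := g) hgm (by fun_prop : Measurable fun r => b * r),
      Real.map_volume_mul_left hb.ne', lintegral_smul_measure, abs_of_pos (inv_pos.2 hb)]
    rfl
  have h2 : ∫⁻ r, g (b * r)
      = ENNReal.ofReal b⁻¹ * ∫⁻ r in Set.Ioi 0, ENNReal.ofReal r⁻¹ * f (b * r) := by
    rw [← lintegral_indicator measurableSet_Ioi, ← lintegral_const_mul _
      (Measurable.indicator (by fun_prop) measurableSet_Ioi)]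
    congr 1 with r
    by_cases hr : 0 < r
    · have hbr : 0 < b * r := mul_pos hb hr
      simp only [hg, Set.indicator_of_mem (Set.mem_Ioi.2 hr), Set.indicator_of_mem
        (Set.mem_Ioi.2 hbr)]
      rw [← mul_assoc, ← ENNReal.ofReal_mul (inv_pos.2 hb).le, mul_inv]
    · have hbr : ¬ 0 < b * r := fun h => hr (pos_of_mul_pos_right h hb.le)
      simp [hg, hr, hbr]
  rw [← lintegral_indicator measurableSet_Ioi (f := fun r => ENNReal.ofReal r⁻¹ * f r)]
  have h3 := h2.symm.trans h1
  exact (ENNReal.mul_right_inj (by simpa using hb) ENNReal.ofReal_ne_top).1 h3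

/-! ### Ball masses and Gaussian averages. -/

variable {d : ℕ}

lemma ballMass_mono (μ : Measure (E d)) [IsFiniteMeasure μ] (y : E d) :
    Monotone (ballMass μ y) := fun _ _ hrs =>
  measureReal_mono fun _ hx => le_trans hx hrs

lemma measurable_ballMass (μ : Measure (E d)) [IsFiniteMeasure μ] (y : E d) :
    Measurable (ballMass μ y) := (ballMass_mono μ y).measurable

lemma norm_ballMass_le (μ : Measure (E d)) [IsFiniteMeasure μ] (y : E d) (r : ℝ) :
    ‖ballMass μ y r‖ ≤ μ.real Set.univ := by
  rw [ballMass, Real.norm_of_nonneg measureReal_nonneg]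
  exact measureReal_mono (Set.subset_univ _)

lemma measurable_dyadicDiff {F : ℝ → ℝ} (hF : Measurable F) (k : ℕ) :
    Measurable (dyadicDiff k F) := by
  induction k with
  | zero => exact hF.sub (hF.comp (by fun_prop))
  | succ k ih => exact ih.sub ((ih.comp (by fun_prop)).const_mul _)

/-- The radial density with `∫_s^∞ gaussDensity c r dr = exp (-c s²)`. -/
noncomputable def gaussDensity (c r : ℝ) : ℝ := 2 * c * r * Real.exp (-c * r ^ 2)

lemma hasDerivAt_neg_exp (c r : ℝ) :
    HasDerivAt (fun r => -Real.exp (-c * r ^ 2)) (gaussDensity c r) r := by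
  have h := ((((hasDerivAt_id r).pow 2).const_mul (-c)).exp).neg
  refine h.congr_deriv ?_
  simp [gaussDensity]; ring

lemma tendsto_neg_exp {c : ℝ} (hc : 0 < c) :
    Filter.Tendsto (fun r => -Real.exp (-c * r ^ 2)) Filter.atTop (nhds 0) := by
  have h : Filter.Tendsto (fun r : ℝ => c * r ^ 2) Filter.atTop Filter.atTop :=
    (Filter.tendsto_pow_atTop (by norm_num)).const_mul_atTop hc
  simpa [neg_mul] using (Real.tendsto_exp_neg_atTop_nhds_zero.comp h).neg

lemma gaussDensity_nonneg {c r : ℝ} (hc : 0 < c) (hr : 0 ≤ r) : 0 ≤ gaussDensity c r := by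
  unfold gaussDensity; positivity

lemma integrableOn_gaussDensity {c s : ℝ} (hc : 0 < c) (hs : 0 ≤ s) :
    IntegrableOn (gaussDensity c) (Set.Ioi s) :=
  integrableOn_Ioi_deriv_of_nonneg' (fun r _ => hasDerivAt_neg_exp c r)
    (fun _ hr => gaussDensity_nonneg hc (hs.trans (le_of_lt hr))) (tendsto_neg_exp hc)

lemma integral_gaussDensity {c s : ℝ} (hc : 0 < c) (hs : 0 ≤ s) :
    ∫ r in Set.Ioi s, gaussDensity c r = Real.exp (-c * s ^ 2) := by
  rw [integral_Ioi_of_hasDerivAt_of_tendsto' (fun r _ => hasDerivAt_neg_exp c r)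
    (integrableOn_gaussDensity hc hs) (tendsto_neg_exp hc)]
  simp

/-- Layer-cake formula: the Gaussian is written as the integral of its radial density over `r ≥ ‖x -
v‖`, and Fubini exchanges `x` and `r`. -/
lemma integral_exp_eq_integral_ballMass (μ : Measure (E d)) [IsFiniteMeasure μ] (v : E d)
    {c : ℝ} (hc : 0 < c) :
    ∫ x, Real.exp (-c * ‖x - v‖ ^ 2) ∂μ
      = ∫ r in Set.Ioi 0, gaussDensity c r * ballMass μ v r := by
  have hms : MeasurableSet {z : E d × ℝ | ‖z.1 - v‖ ≤ z.2} :=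
    measurableSet_le (by fun_prop) (by fun_prop)
  have h1 : ∀ x : E d, Real.exp (-c * ‖x - v‖ ^ 2) = ∫ r in Set.Ioi 0,
      {z : E d × ℝ | ‖z.1 - v‖ ≤ z.2}.indicator (fun z => gaussDensity c z.2) (x, r) := by
    intro x
    have : ∀ r, {z : E d × ℝ | ‖z.1 - v‖ ≤ z.2}.indicator (fun z => gaussDensity c z.2) (x, r)
        = (Set.Ici ‖x - v‖).indicator (gaussDensity c) r := fun r => by
      simp [Set.indicator_apply]
    simp_rw [this]
    rw [setIntegral_indicator measurableSet_Ici, ← integral_gaussDensity hc (norm_nonneg (x - v))]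
    refine (setIntegral_congr_set ?_).symm
    rcases (norm_nonneg (x - v)).eq_or_lt with h | h
    · rw [← h, Set.inter_eq_left.2 Set.Ioi_subset_Ici_self]
      exact Filter.EventuallyEq.rfl
    · rw [Set.inter_eq_right.2 (Set.Ici_subset_Ioi.2 h)]
      exact Ioi_ae_eq_Ici.symm
  simp_rw [h1]
  rw [integral_integral_swap]
  · refine integral_congr_ae (Filter.Eventually.of_forall fun r => ?_)
    have : ∀ x, {z : E d × ℝ | ‖z.1 - v‖ ≤ z.2}.indicator (fun z => gaussDensity c z.2) (x, r)
        = {x : E d | ‖x - v‖ ≤ r}.indicator (fun _ => gaussDensity c r) x := fun x => by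
      simp [Set.indicator_apply]
    simp_rw [this]
    rw [integral_indicator (measurableSet_le (by fun_prop) (by fun_prop)), setIntegral_const]
    simp [ballMass, mul_comm]
  · exact (((integrableOn_gaussDensity hc le_rfl).comp_snd μ).indicator hms)

/-- Halving the radius in `F` amounts to multiplying the Gaussian parameter by `4`; this is the
origin of the factors `4 ^ i` in `gaussSum`. -/
lemma integral_gaussDensity_mul_comp_div (F : ℝ → ℝ) (c : ℝ) (i : ℕ) :
    ∫ r in Set.Ioi 0, gaussDensity c r * F (r / 2 ^ i)
      = ∫ r in Set.Ioi 0, gaussDensity (4 ^ i * c) r * F r := by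
  have h := integral_comp_mul_left_Ioi (fun r => gaussDensity (4 ^ i * c) r * F r) 0
    (b := (2 ^ i)⁻¹) (by positivity)
  have h2 : ∀ r : ℝ, gaussDensity (4 ^ i * c) ((2 ^ i)⁻¹ * r) * F ((2 ^ i)⁻¹ * r)
      = 2 ^ i * (gaussDensity c r * F (r / 2 ^ i)) := by
    intro r
    have h4 : (4 : ℝ) ^ i = 2 ^ i * 2 ^ i := by rw [← mul_pow]; norm_num
    have e1 : -(4 ^ i * c) * ((2 ^ i)⁻¹ * r) ^ 2 = -c * r ^ 2 := by rw [h4]; field_simp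
    rw [gaussDensity, e1, gaussDensity, h4, inv_mul_eq_div]
    field_simp
  simp_rw [h2] at h
  rw [integral_const_mul, mul_zero, inv_inv, smul_eq_mul] at h
  exact mul_left_cancel₀ (by positivity) h

/-- The combination of dilated Gaussians that matches a linear combination of dyadic dilations of
the ball masses. -/
noncomputable def gaussSum (a : ℕ → ℝ) (n : ℕ) (c : ℝ) (u : E d) : ℝ :=
  ∑ i ∈ Finset.range n, a i * Real.exp (-(4 ^ i * c) * ‖u‖ ^ 2)

lemma continuous_gaussSum (a : ℕ → ℝ) (n : ℕ) (c : ℝ) :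
    Continuous (gaussSum a n c : E d → ℝ) := by
  unfold gaussSum; fun_prop

lemma norm_gaussSum_le (a : ℕ → ℝ) (n : ℕ) {c : ℝ} (hc : 0 < c) (u : E d) :
    ‖gaussSum a n c u‖ ≤ ∑ i ∈ Finset.range n, |a i| := by
  refine (norm_sum_le _ _).trans (Finset.sum_le_sum fun i _ => ?_)
  rw [norm_mul, Real.norm_eq_abs, Real.norm_of_nonneg (Real.exp_pos _).le]
  refine mul_le_of_le_one_right (abs_nonneg _) (Real.exp_le_one_iff.2 ?_)
  rw [neg_mul, neg_nonpos]
  positivity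

lemma integral_gaussSum_eq {k : ℕ} {a : ℕ → ℝ}
    (ha : ∀ F r, dyadicDiff k F r = ∑ i ∈ Finset.range (k + 2), a i * F (r / 2 ^ i))
    (μ : Measure (E d)) [IsFiniteMeasure μ] (v : E d) {c : ℝ} (hc : 0 < c) :
    ∫ x, gaussSum a (k + 2) c (x - v) ∂μ
      = ∫ r in Set.Ioi 0, gaussDensity c r * dyadicDiff k (ballMass μ v) r := by
  simp_rw [ha, Finset.mul_sum, gaussSum]
  rw [integral_finsetSum, integral_finsetSum]
  · refine Finset.sum_congr rfl fun i _ => ?_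
    have e : ∀ r, gaussDensity c r * (a i * ballMass μ v (r / 2 ^ i))
      = a i * (gaussDensity c r * ballMass μ v (r / 2 ^ i)) := fun r => by ring
    simp_rw [e]
    rw [integral_const_mul, integral_const_mul, integral_gaussDensity_mul_comp_div,
      integral_exp_eq_integral_ballMass μ v (by positivity)]
  · intro i _
    refine (integrableOn_gaussDensity hc le_rfl).mul_bdd
      (((measurable_ballMass μ v).comp (by fun_prop)).const_mul _).aestronglyMeasurable
      (c := |a i| * μ.real Set.univ) (Filter.Eventually.of_forall fun r => ?_)
    rw [norm_mul, Real.norm_eq_abs]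
    gcongr
    exact norm_ballMass_le μ v _
  · intro i _
    refine Integrable.of_bound (by fun_prop) |a i| (Filter.Eventually.of_forall fun x => ?_)
    rw [norm_mul, Real.norm_eq_abs, Real.norm_of_nonneg (Real.exp_pos _).le]
    refine mul_le_of_le_one_right (abs_nonneg _) (Real.exp_le_one_iff.2 ?_)
    rw [neg_mul, neg_nonpos]
    positivity

/-! ### Hölder's inequality in the radius. -/

/-- The weight which is paired with `r ^ (-s) * F r` in Hölder's inequality. -/
noncomputable def holderWeight (s r : ℝ) : ℝ := 2 * r ^ (s + 2) * Real.exp (-r ^ 2)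

lemma measurable_holderWeight (s : ℝ) : Measurable (holderWeight s) := by
  unfold holderWeight; fun_prop

lemma eLpNorm_holderWeight_lt_top {s : ℝ} (hs : 0 ≤ s) (q : ℝ≥0∞) :
    eLpNorm (holderWeight s) q radialMeasure < ∞ := by
  rcases eq_or_ne q ∞ with rfl | hqt
  · obtain ⟨n, hn⟩ := exists_nat_ge ((s + 2) / 2)
    -- The constant comes from `r^(s+2) ≤ 1 + r^(2n)` and `r^(2n) ≤ n! exp (r²)`.
    refine (eLpNormEssSup_le_of_ae_bound (C := 2 * (1 + n.factorial)) ?_).trans_lt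
      ENNReal.ofReal_lt_top
    filter_upwards [ae_radialMeasure_pos] with r hr
    have h1 : r ^ (s + 2) ≤ 1 + r ^ (2 * n) := by
      rcases le_total r 1 with h | h
      · exact (Real.rpow_le_one hr.le h (by linarith)).trans (by simp; positivity)
      · have : r ^ (s + 2) ≤ r ^ ((2 * n : ℕ) : ℝ) :=
          Real.rpow_le_rpow_of_exponent_le h (by push_cast; linarith)
        rw [Real.rpow_natCast] at this
        linarith
    have h2 : r ^ (2 * n) ≤ n.factorial * Real.exp (r ^ 2) := by
      have := Real.pow_div_factorial_le_exp (r ^ 2) (by positivity) n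
      rw [div_le_iff₀ (by positivity)] at this
      rw [pow_mul]; linarith
    have h3 : 1 ≤ Real.exp (r ^ 2) := Real.one_le_exp (by positivity)
    rw [holderWeight, Real.norm_of_nonneg (by positivity), Real.exp_neg,
      ← div_eq_mul_inv, div_le_iff₀ (Real.exp_pos _)]
    nlinarith
  rcases eq_or_ne q 0 with rfl | hq0
  · simp
  have hq : 0 < q.toReal := ENNReal.toReal_pos hq0 hqt
  rw [eLpNorm_lt_top_iff_lintegral_rpow_enorm_lt_top hq0 hqt, lintegral_radialMeasure]
  -- The `-1` in the exponent is the density of `dr / r`.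
  have hint := (integrableOn_rpow_mul_exp_neg_mul_sq hq (s := (s + 2) * q.toReal - 1)
    (by nlinarith)).const_mul (2 ^ q.toReal)
  refine lt_of_le_of_lt (setLIntegral_mono' measurableSet_Ioi fun r (hr : 0 < r) => ?_)
    hint.lintegral_lt_top
  have hw : 0 ≤ holderWeight s r := by unfold holderWeight; positivity
  rw [← ofReal_norm, Real.norm_of_nonneg hw, ENNReal.ofReal_rpow_of_nonneg hw hq.le,
    ← ENNReal.ofReal_mul (by positivity)]
  refine ENNReal.ofReal_le_ofReal (le_of_eq ?_)
  rw [holderWeight, Real.mul_rpow (by positivity) (by positivity), Real.mul_rpow (by positivity)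
    (by positivity), ← Real.rpow_mul hr.le, ← Real.exp_mul, Real.rpow_sub hr, Real.rpow_one]
  rw [show -q.toReal * r ^ 2 = -r ^ 2 * q.toReal by ring]
  field_simp

/-- With respect to `dr / r` the Gaussian density becomes `2 (br)² exp (-(br)²)`, and `r^s = b^(-s)
(br)^s`. The dilated weight has the same norm as the weight itself by invariance of `dr / r`, so `b`
enters only through `b^(-s)`. -/
lemma enorm_integral_gaussDensity_le {F : ℝ → ℝ} (hF : Measurable F) {b s : ℝ} (hb : 0 < b)
    {p p' : ℝ≥0∞} [ENNReal.HolderConjugate p' p] :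
    ‖∫ r in Set.Ioi 0, gaussDensity (b ^ 2) r * F r‖ₑ
      ≤ ENNReal.ofReal (b ^ (-s)) * eLpNorm (holderWeight s) p' radialMeasure
        * eLpNorm (fun r => r ^ (-s) * F r) p radialMeasure := by
  have hH : eLpNorm (fun r => holderWeight s (b * r)) p' radialMeasure
      = eLpNorm (holderWeight s) p' radialMeasure := by
    rw [← eLpNorm_comp_measurePreserving (measurable_holderWeight s).aestronglyMeasurable
      (measurePreserving_mul_radialMeasure hb)]
    rfl
  have hbs : 0 < b ^ (-s) := Real.rpow_pos_of_pos hb _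
  calc ‖∫ r in Set.Ioi 0, gaussDensity (b ^ 2) r * F r‖ₑ
      ≤ ∫⁻ r in Set.Ioi 0, ‖gaussDensity (b ^ 2) r * F r‖ₑ := enorm_integral_le_lintegral_enorm _
    _ = ∫⁻ r in Set.Ioi 0, ENNReal.ofReal r⁻¹ * (ENNReal.ofReal (b ^ (-s)) *
          ‖holderWeight s (b * r) * (r ^ (-s) * F r)‖ₑ) := by
        refine setLIntegral_congr_fun measurableSet_Ioi fun r (hr : 0 < r) => ?_
        have e : gaussDensity (b ^ 2) r * F r
            = r⁻¹ * (b ^ (-s) * (holderWeight s (b * r) * (r ^ (-s) * F r))) := by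
          rw [gaussDensity, holderWeight, Real.rpow_add (by positivity), Real.mul_rpow hb.le hr.le,
            Real.rpow_neg hb.le, Real.rpow_neg hr.le, Real.rpow_two,
            show -(b ^ 2) * r ^ 2 = -(b * r) ^ 2 by ring]
          have := (Real.rpow_pos_of_pos hb s).ne'
          have := (Real.rpow_pos_of_pos hr s).ne'
          field_simp
        simp only [e]
        rw [enorm_mul, enorm_mul, Real.enorm_of_nonneg (inv_pos.2 hr).le,
          Real.enorm_of_nonneg hbs.le]
    _ = ENNReal.ofReal (b ^ (-s)) *
          eLpNorm ((fun r => holderWeight s (b * r)) • fun r => r ^ (-s) * F r) 1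
            radialMeasure := by
        rw [← lintegral_radialMeasure, lintegral_const_mul, eLpNorm_one_eq_lintegral_enorm]
        · rfl
        · have := measurable_holderWeight s
          fun_prop
    _ ≤ _ := by
        rw [mul_assoc]
        gcongr
        rw [← hH]
        refine eLpNorm_smul_le_mul_eLpNorm (Measurable.aestronglyMeasurable (by fun_prop))
          (Measurable.aestronglyMeasurable ?_)
        exact (measurable_holderWeight s).comp (by fun_prop)

/-! ### Fourier transforms of products and of Gaussians. -/

lemma fourier_mul_fourierInv {m g : E d → ℂ} (hm : Integrable m) (hg : Integrable g) (x : E d) :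
    𝓕 (fun ξ => m ξ * 𝓕⁻ g ξ) x = ∫ y, 𝓕 m (x - y) * g y := by
  simp only [Real.fourier_eq', Real.fourierInv_eq', smul_eq_mul]
  simp_rw [← integral_const_mul, ← integral_mul_const]
  rw [integral_integral_swap]
  · refine integral_congr_ae (Filter.Eventually.of_forall fun y =>
      integral_congr_ae (Filter.Eventually.of_forall fun ξ => ?_))
    have e : Complex.exp (((-2 * Real.pi * ⟪ξ, x - y⟫ : ℝ) : ℂ) * Complex.I)
        = Complex.exp (((-2 * Real.pi * ⟪ξ, x⟫ : ℝ) : ℂ) * Complex.I)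
          * Complex.exp (((2 * Real.pi * ⟪y, ξ⟫ : ℝ) : ℂ) * Complex.I) := by
      rw [← Complex.exp_add, inner_sub_right, real_inner_comm ξ y]
      congr 1; push_cast; ring
    simp only [e]
    ring
  · have h1 : Integrable (fun z : E d × E d => m z.1 * g z.2) (volume.prod volume) :=
      hm.mul_prod hg
    have h2 := h1.bdd_mul (c := 1) (f := fun z : E d × E d =>
      Complex.exp (((-2 * Real.pi * ⟪z.1, x⟫ : ℝ) : ℂ) * Complex.I)
        * Complex.exp (((2 * Real.pi * ⟪z.2, z.1⟫ : ℝ) : ℂ) * Complex.I))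
      (Continuous.aestronglyMeasurable (by fun_prop))
      (Filter.Eventually.of_forall fun z => by
        rw [norm_mul, Complex.norm_exp_ofReal_mul_I, Complex.norm_exp_ofReal_mul_I, mul_one])
    refine h2.congr (Filter.Eventually.of_forall fun z => ?_)
    simp only [Function.uncurry]
    ring

/-- The Fourier transform of `gaussSum`. -/
noncomputable def gaussSymbol (a : ℕ → ℝ) (n : ℕ) (c : ℝ) (ξ : E d) : ℝ :=
  ∑ i ∈ Finset.range n, a i * ((Real.pi / (4 ^ i * c)) ^ ((d : ℝ) / 2)
    * Real.exp (-(Real.pi ^ 2 * ‖ξ‖ ^ 2 / c) / 4 ^ i))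

lemma integrable_exp_neg_mul_norm_sq {c : ℝ} (hc : 0 < c) :
    Integrable fun u : E d => Real.exp (-c * ‖u‖ ^ 2) := by
  have h := (GaussianFourier.integrable_cexp_neg_mul_sq_norm_add (V := E d) (b := (c : ℂ))
    (by simpa using hc) 0 0).re
  refine h.congr (Filter.Eventually.of_forall fun u => ?_)
  simp only [zero_mul, add_zero]
  norm_cast

lemma integrable_gaussSum (a : ℕ → ℝ) (n : ℕ) {c : ℝ} (hc : 0 < c) :
    Integrable (gaussSum a n c : E d → ℝ) :=
  integrable_finsetSum _ fun i _ => (integrable_exp_neg_mul_norm_sq (by positivity)).const_mul _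

lemma fourier_exp_neg_mul_norm_sq {c : ℝ} (hc : 0 < c) (ξ : E d) :
    𝓕 (fun u : E d => ((Real.exp (-c * ‖u‖ ^ 2) : ℝ) : ℂ)) ξ
      = (((Real.pi / c) ^ ((d : ℝ) / 2) * Real.exp (-(Real.pi ^ 2 * ‖ξ‖ ^ 2 / c)) : ℝ) : ℂ) := by
  have h := fourier_gaussian_innerProductSpace (V := E d) (b := (c : ℂ)) (by simpa using hc) ξ
  rw [finrank_euclideanSpace_fin] at h
  push_cast at h ⊢
  rw [h, Complex.ofReal_cpow (by positivity)]
  push_cast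
  congr 2
  ring

lemma fourierInv_gaussSum (a : ℕ → ℝ) (n : ℕ) {c : ℝ} (hc : 0 < c) (ξ : E d) :
    𝓕⁻ (fun u : E d => ((gaussSum a n c u : ℝ) : ℂ)) ξ = ((gaussSymbol a n c ξ : ℝ) : ℂ) := by
  rw [Real.fourierInv_eq_fourier_neg, Real.fourier_eq']
  simp only [gaussSum, Complex.ofReal_sum, Finset.smul_sum]
  rw [integral_finsetSum]
  · rw [gaussSymbol, Complex.ofReal_sum]
    refine Finset.sum_congr rfl fun i _ => ?_
    have h4 : (0 : ℝ) < 4 ^ i * c := by positivity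
    have h := fourier_exp_neg_mul_norm_sq (d := d) h4 (-ξ)
    rw [Real.fourier_eq', norm_neg] at h
    rw [Complex.ofReal_mul (a i), show -(Real.pi ^ 2 * ‖ξ‖ ^ 2 / c) / 4 ^ i
      = -(Real.pi ^ 2 * ‖ξ‖ ^ 2 / (4 ^ i * c)) by field_simp, ← h, ← integral_const_mul]
    refine integral_congr_ae (Filter.Eventually.of_forall fun u => ?_)
    simp only [smul_eq_mul, Complex.ofReal_mul]
    ring
  · intro i _
    have h4 : (0 : ℝ) < 4 ^ i * c := by positivity
    simp only [smul_eq_mul]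
    refine (((integrable_exp_neg_mul_norm_sq (d := d) h4).const_mul (a i)).ofReal (𝕜 := ℂ)).bdd_mul
      (c := 1) (Continuous.aestronglyMeasurable (by fun_prop))
      (Filter.Eventually.of_forall fun z => ?_)
    rw [Complex.norm_exp_ofReal_mul_I]

/-! ### Fourier multipliers applied to a finite measure. -/

lemma exists_schwartzMap_eq_fourier {m : E d → ℂ} (hm : ContDiff ℝ (⊤ : ℕ∞) m)
    (hs : HasCompactSupport m) : ∃ N : 𝓢(E d, ℂ), ⇑N = 𝓕 m :=
  ⟨𝓕 (hs.toSchwartzMap hm), by rw [SchwartzMap.fourier_coe]; rfl⟩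

lemma integrable_of_contDiff_hasCompactSupport {m : E d → ℂ} (hm : ContDiff ℝ (⊤ : ℕ∞) m)
    (hs : HasCompactSupport m) : Integrable m :=
  hm.continuous.integrable_of_hasCompactSupport hs

lemma exists_norm_fourier_le {m : E d → ℂ} (hm : ContDiff ℝ (⊤ : ℕ∞) m)
    (hs : HasCompactSupport m) : ∃ C, ∀ x, ‖𝓕 m x‖ ≤ C := by
  obtain ⟨N, hN⟩ := exists_schwartzMap_eq_fourier hm hs
  obtain ⟨C, -, hC⟩ := N.decay 0 0
  exact ⟨C, fun x => by simpa [← hN] using hC x⟩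

lemma continuous_fourier {m : E d → ℂ} (hm : ContDiff ℝ (⊤ : ℕ∞) m)
    (hs : HasCompactSupport m) : Continuous (𝓕 m) := by
  obtain ⟨N, hN⟩ := exists_schwartzMap_eq_fourier hm hs
  exact hN ▸ N.continuous

lemma integrable_fourier {m : E d → ℂ} (hm : ContDiff ℝ (⊤ : ℕ∞) m)
    (hs : HasCompactSupport m) : Integrable (𝓕 m) := by
  obtain ⟨N, hN⟩ := exists_schwartzMap_eq_fourier hm hs
  exact hN ▸ N.integrable

/-- The function that represents the Fourier multiplier with symbol `m` applied to `μ`. -/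
noncomputable def multiplierFun (m : E d → ℂ) (μ : Measure (E d)) (y : E d) : ℂ :=
  ∫ x, 𝓕 m (x - y) ∂μ

lemma aestronglyMeasurable_multiplierFun {m : E d → ℂ} (hm : ContDiff ℝ (⊤ : ℕ∞) m)
    (hs : HasCompactSupport m) (μ : Measure (E d)) [IsFiniteMeasure μ] :
    AEStronglyMeasurable (multiplierFun m μ) volume := by
  have h := continuous_fourier hm hs
  have : StronglyMeasurable (Function.uncurry fun (y x : E d) => 𝓕 m (x - y)) :=
    Continuous.stronglyMeasurable (by unfold Function.uncurry; fun_prop)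
  exact this.integral_prod_right.aestronglyMeasurable

/-- By duality the multiplier moves to the test function as `𝓕 (m 𝓕⁻ g)`, a convolution with `𝓕 m`.
Fubini applies since `𝓕 m` is bounded, `g` integrable and `μ` finite. -/
lemma fourierMultiplierCLM_toTemperedDistribution_apply {m : E d → ℂ}
    (hm : ContDiff ℝ (⊤ : ℕ∞) m) (hs : HasCompactSupport m) (μ : Measure (E d))
    [IsFiniteMeasure μ] (g : 𝓢(E d, ℂ)) :
    TemperedDistribution.fourierMultiplierCLM ℂ m μ.toTemperedDistribution g
      = ∫ y, g y * multiplierFun m μ y := by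
  have hcont := continuous_fourier hm hs
  obtain ⟨C, hC⟩ := exists_norm_fourier_le hm hs
  rw [TemperedDistribution.fourierMultiplierCLM_apply_apply, Measure.toTemperedDistribution_apply μ]
  have h1 : ∀ x, (𝓕 (SchwartzMap.smulLeftCLM ℂ m (𝓕⁻ g)) : 𝓢(E d, ℂ)) x
      = ∫ y, 𝓕 m (x - y) * g y := by
    intro x
    rw [← fourier_mul_fourierInv (integrable_of_contDiff_hasCompactSupport hm hs) g.integrable,
      SchwartzMap.fourier_coe, SchwartzMap.smulLeftCLM_apply (hs.hasTemperateGrowth hm),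
      SchwartzMap.fourierInv_coe]
    rfl
  simp_rw [h1, multiplierFun, ← integral_const_mul]
  rw [integral_integral_swap]
  · simp_rw [mul_comm]
  · refine (g.integrable (μ := volume).comp_snd μ).bdd_mul (c := C)
      (f := fun z : E d × E d => 𝓕 m (z.1 - z.2))
      (Continuous.aestronglyMeasurable (by fun_prop))
      (Filter.Eventually.of_forall fun z => hC _)

/-- Membership of `f` in `L^q` need not be known: otherwise the right side is `∞`. -/
lemma distLpNorm_le {q : ℝ≥0∞} {T : 𝓢'(E d, ℂ)} {f : E d → ℂ}
    (hf : AEStronglyMeasurable f volume) (hT : ∀ g : 𝓢(E d, ℂ), T g = ∫ x, g x * f x) :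
    distLpNorm q T ≤ eLpNorm f q volume := by
  by_cases h : eLpNorm f q volume < ∞
  · exact iInf₂_le_of_le f ⟨hf, h⟩ (iInf_le _ hT)
  · rw [not_lt_top_iff.1 h]; exact le_top

lemma distLpNorm_multiplier_le_eLpNorm (q : ℝ≥0∞) {m : E d → ℂ}
    (hm : ContDiff ℝ (⊤ : ℕ∞) m) (hs : HasCompactSupport m) (μ : Measure (E d))
    [IsFiniteMeasure μ] :
    distLpNorm q (TemperedDistribution.fourierMultiplierCLM ℂ m μ.toTemperedDistribution)
      ≤ eLpNorm (multiplierFun m μ) q volume :=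
  distLpNorm_le (aestronglyMeasurable_multiplierFun hm hs μ)
    (fourierMultiplierCLM_toTemperedDistribution_apply hm hs μ)

lemma distLpNorm_multiplier_le_mass {q : ℝ≥0∞} (hq : 1 ≤ q) {m : E d → ℂ}
    (hm : ContDiff ℝ (⊤ : ℕ∞) m) (hs : HasCompactSupport m) (μ : Measure (E d))
    [IsFiniteMeasure μ] :
    distLpNorm q (TemperedDistribution.fourierMultiplierCLM ℂ m μ.toTemperedDistribution)
      ≤ μ Set.univ * eLpNorm (𝓕 m) q volume := by
  have hcont := continuous_fourier hm hs
  refine (distLpNorm_multiplier_le_eLpNorm q hm hs μ).trans ?_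
  refine (eLpNorm_mono_enorm (g := fun y => ∫⁻ x, ‖𝓕 m (x - y)‖ₑ ∂μ) fun y => ?_).trans
    (eLpNorm_lintegral_le μ volume hq (fun x y => ‖𝓕 m (x - y)‖ₑ) ?_ _ fun x => ?_)
  · exact enorm_integral_le_lintegral_enorm _
  · exact (hcont.comp (by fun_prop : Continuous fun z : E d × E d => z.1 - z.2)).measurable.enorm
  · rw [eLpNorm_enorm]
    exact (eLpNorm_comp_measurePreserving hcont.aestronglyMeasurable
      (volume.measurePreserving_sub_left x)).le

/-- A factorisation of the symbol is a convolution in space: the Gaussian averages of `μ` are formed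
first and then integrated against `𝓕 h`. -/
lemma multiplierFun_eq {m h : E d → ℂ} (hh : ContDiff ℝ (⊤ : ℕ∞) h) (hs : HasCompactSupport h)
    {a : ℕ → ℝ} {n : ℕ} {c : ℝ} (hc : 0 < c)
    (hmh : ∀ ξ, m ξ = h ξ * (gaussSymbol a n c ξ : ℝ)) (μ : Measure (E d)) [IsFiniteMeasure μ]
    (y : E d) :
    multiplierFun m μ y = ∫ w, 𝓕 h w * ((∫ x, gaussSum a n c (x - (y + w)) ∂μ : ℝ) : ℂ) := by
  have hm : m = fun ξ => h ξ * 𝓕⁻ (fun u : E d => ((gaussSum a n c u : ℝ) : ℂ)) ξ := by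
    ext ξ; rw [hmh, fourierInv_gaussSum a n hc]
  have hi : Integrable fun u : E d => ((gaussSum a n c u : ℝ) : ℂ) :=
    (integrable_gaussSum a n hc).ofReal
  have h1 : ∀ x, 𝓕 m (x - y) = ∫ w, 𝓕 h w * ((gaussSum a n c (x - (y + w)) : ℝ) : ℂ) := by
    intro x
    rw [hm, fourier_mul_fourierInv (integrable_of_contDiff_hasCompactSupport hh hs) hi,
      ← integral_sub_left_eq_self _ volume (x - y)]
    refine integral_congr_ae (Filter.Eventually.of_forall fun w => ?_)
    beta_reduce
    rw [sub_sub_cancel, sub_sub]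
  have hcont := continuous_gaussSum (d := d) a n c
  simp_rw [multiplierFun, h1, ← integral_complex_ofReal, ← integral_const_mul]
  rw [integral_integral_swap]
  · refine ((integrable_fourier hh hs).comp_snd μ).mul_bdd (c := ∑ i ∈ Finset.range n, |a i|)
      (Continuous.aestronglyMeasurable (by fun_prop))
      (Filter.Eventually.of_forall fun z => ?_)
    rw [Complex.norm_real]
    exact norm_gaussSum_le a n hc _

/-- This is Young's inequality, in the form of Minkowski's inequality for the finite measure `|𝓕 h|
dw` and the translates of the Gaussian average. -/
lemma distLpNorm_multiplier_le_gauss {q : ℝ≥0∞} (hq : 1 ≤ q) {m h : E d → ℂ}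
    (hm : ContDiff ℝ (⊤ : ℕ∞) m) (hms : HasCompactSupport m)
    (hh : ContDiff ℝ (⊤ : ℕ∞) h) (hs : HasCompactSupport h)
    {a : ℕ → ℝ} {n : ℕ} {c : ℝ} (hc : 0 < c)
    (hmh : ∀ ξ, m ξ = h ξ * (gaussSymbol a n c ξ : ℝ)) (μ : Measure (E d)) [IsFiniteMeasure μ] :
    distLpNorm q (TemperedDistribution.fourierMultiplierCLM ℂ m μ.toTemperedDistribution)
      ≤ (∫⁻ w, ‖𝓕 h w‖ₑ) * eLpNorm (fun v => ∫ x, gaussSum a n c (x - v) ∂μ) q volume := by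
  set A : E d → ℝ := fun v => ∫ x, gaussSum a n c (x - v) ∂μ with hA
  have hAm : Measurable A := by
    have hcont := continuous_gaussSum (d := d) a n c
    have : StronglyMeasurable (Function.uncurry fun (v x : E d) => gaussSum a n c (x - v)) :=
      Continuous.stronglyMeasurable (by unfold Function.uncurry; fun_prop)
    exact this.integral_prod_right.measurable
  have hhm : Measurable fun w => ‖𝓕 h w‖ₑ := (continuous_fourier hh hs).measurable.enorm
  let ν : Measure (E d) := volume.withDensity fun w => ‖𝓕 h w‖ₑ
  have hν : ν Set.univ = ∫⁻ w, ‖𝓕 h w‖ₑ := by simp [ν]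
  have : IsFiniteMeasure ν := ⟨by rw [hν]; exact (integrable_fourier hh hs).2⟩
  refine (distLpNorm_multiplier_le_eLpNorm q hm hms μ).trans ?_
  rw [← hν]
  refine (eLpNorm_mono_enorm (g := fun y => ∫⁻ w, ‖A (y + w)‖ₑ ∂ν) fun y => ?_).trans
    (eLpNorm_lintegral_le ν volume hq (fun w y => ‖A (y + w)‖ₑ) ?_ _ fun w => ?_)
  · rw [multiplierFun_eq hh hs hc hmh]
    refine (enorm_integral_le_lintegral_enorm _).trans (le_of_eq ?_)
    rw [lintegral_withDensity_eq_lintegral_mul _ hhm (by fun_prop), enorm_eq_self]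
    refine lintegral_congr fun w => ?_
    rw [enorm_mul, Pi.mul_apply]
    congr 1
    simp [enorm_eq_nnnorm, hA]
  · unfold Function.uncurry; fun_prop
  · rw [eLpNorm_enorm]
    exact (eLpNorm_comp_measurePreserving hAm.aestronglyMeasurable
      (measurePreserving_add_right volume w)).le

/-! ### Zeros and scaling of the Gaussian symbol; division of the annulus. -/

lemma gaussSymbol_eq (a : ℕ → ℝ) (n : ℕ) {c : ℝ} (hc : 0 < c) (ξ : E d) :
    gaussSymbol a n c ξ = (Real.pi / c) ^ ((d : ℝ) / 2) * ∑ i ∈ Finset.range n,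
      (a i * (1 / 4 ^ i) ^ ((d : ℝ) / 2)) * Real.exp (-(Real.pi ^ 2 * ‖ξ‖ ^ 2 / c) / 4 ^ i) := by
  rw [gaussSymbol, Finset.mul_sum]
  refine Finset.sum_congr rfl fun i _ => ?_
  rw [show Real.pi / (4 ^ i * c) = (Real.pi / c) * (1 / 4 ^ i) by field_simp,
    Real.mul_rpow (by positivity) (by positivity)]
  ring

lemma gaussSymbol_dilate (a : ℕ → ℝ) (n : ℕ) {c t : ℝ} (hc : 0 < c) (ht : 0 < t) (ξ : E d) :
    t ^ d * gaussSymbol a n (c * t ^ 2) ξ = gaussSymbol a n c (t⁻¹ • ξ) := by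
  rw [gaussSymbol_eq a n (by positivity), gaussSymbol_eq a n hc, norm_smul,
    Real.norm_of_nonneg (by positivity), ← mul_assoc]
  congr 1
  · rw [show Real.pi / c = Real.pi / (c * t ^ 2) * t ^ 2 by field_simp,
      Real.mul_rpow (x := Real.pi / (c * t ^ 2)) (by positivity) (by positivity),
      ← Real.rpow_natCast t 2, ← Real.rpow_mul ht.le, mul_comm, ← Real.rpow_natCast t d]
    congr 2
    push_cast; ring
  · refine Finset.sum_congr rfl fun i _ => ?_
    congr 3
    field_simp

lemma exists_gaussSymbol_ne_zero (d n : ℕ) (a : ℕ → ℝ) (ha : a n ≠ 0) :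
    ∃ b : ℝ, 0 < b ∧ ∀ ξ : E d, 1 / 4 ≤ ‖ξ‖ → gaussSymbol a (n + 1) (b ^ 2) ξ ≠ 0 := by
  obtain ⟨T, hT0, hT⟩ := exists_sum_exp_ne_zero n
    (fun i => a i * (1 / 4 ^ i) ^ ((d : ℝ) / 2)) (by positivity)
  -- This `b` makes the variable of the exponential sum `16 T ‖ξ‖²`, which is at least `T` once `‖ξ‖
  -- ≥ 1/4`.
  refine ⟨√(Real.pi ^ 2 / (16 * T)), Real.sqrt_pos.2 (by positivity), fun ξ hξ => ?_⟩
  rw [Real.sq_sqrt (by positivity), gaussSymbol_eq a _ (by positivity)]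
  refine mul_ne_zero (by positivity) (hT _ ?_)
  rw [show Real.pi ^ 2 * ‖ξ‖ ^ 2 / (Real.pi ^ 2 / (16 * T)) = T * (16 * ‖ξ‖ ^ 2) by field_simp]
  refine le_mul_of_one_le_right hT0.le ?_
  nlinarith

lemma contDiff_gaussSymbol (a : ℕ → ℝ) (n : ℕ) (c : ℝ) :
    ContDiff ℝ (⊤ : ℕ∞) (gaussSymbol a n c : E d → ℝ) := by
  unfold gaussSymbol
  refine ContDiff.sum fun i _ => contDiff_const.mul (contDiff_const.mul ?_)
  exact ((((contDiff_const.mul (contDiff_norm_sq ℝ)).div_const _).neg).div_const _).exp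

/-- The symbol of the dyadic block of frequency `1`. -/
def annulus (χ : E d → ℝ) (ξ : E d) : ℝ := χ ξ - χ ((2 : ℝ) • ξ)

lemma IsLPCutoff.contDiff_annulus {χ : E d → ℝ} (hχ : IsLPCutoff χ) :
    ContDiff ℝ (⊤ : ℕ∞) (annulus χ) :=
  hχ.smooth.sub (hχ.smooth.comp (contDiff_id.const_smul _))

lemma IsLPCutoff.annulus_eq_zero_of_le {χ : E d → ℝ} (hχ : IsLPCutoff χ) {ξ : E d}
    (hξ : ‖ξ‖ ≤ 1 / 2) : annulus χ ξ = 0 := by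
  rw [annulus, hχ.eq_one ξ (by linarith), hχ.eq_one _ (by rw [norm_smul]; norm_num; linarith),
    sub_self]

lemma IsLPCutoff.annulus_eq_zero_of_ge {χ : E d → ℝ} (hχ : IsLPCutoff χ) {ξ : E d}
    (hξ : 2 ≤ ‖ξ‖) : annulus χ ξ = 0 := by
  rw [annulus, hχ.eq_zero ξ hξ, hχ.eq_zero _ (by rw [norm_smul]; norm_num; linarith), sub_self]

lemma hasCompactSupport_of_eq_zero {F : Type*} [Zero F] {f : E d → F} (r : ℝ)
    (h : ∀ ξ, r ≤ ‖ξ‖ → f ξ = 0) : HasCompactSupport f :=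
  HasCompactSupport.intro (isCompact_closedBall 0 r) fun ξ hξ => h ξ (by
    rw [mem_closedBall_zero_iff, not_le] at hξ; exact hξ.le)

/-- The numerator vanishes on the ball of radius `1/2` and the denominator has no zero beyond radius
`1/4`, so one of two reasons for smoothness holds near every point. -/
lemma IsLPCutoff.contDiff_annulus_div {χ : E d → ℝ} (hχ : IsLPCutoff χ) {G : E d → ℝ}
    (hG : ContDiff ℝ (⊤ : ℕ∞) G) (h0 : ∀ ξ, 1 / 4 ≤ ‖ξ‖ → G ξ ≠ 0) :
    ContDiff ℝ (⊤ : ℕ∞) fun ξ => annulus χ ξ / G ξ := by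
  rw [contDiff_iff_contDiffAt]
  intro ξ
  rcases lt_or_ge ‖ξ‖ (1 / 2) with h | h
  · refine (contDiffAt_const (c := (0 : ℝ))).congr_of_eventuallyEq ?_
    filter_upwards [(isOpen_lt continuous_norm continuous_const).mem_nhds h] with η hη
    rw [hχ.annulus_eq_zero_of_le (le_of_lt hη), zero_div]
  · exact hχ.contDiff_annulus.contDiffAt.div hG.contDiffAt (h0 ξ (by linarith))

/-- The transform is `t^{2d} 𝓕 h(t x)`, and the substitution in `x` takes back one factor `t^d`. -/
lemma lintegral_enorm_fourier_dilate {h : E d → ℂ} (hm : Measurable (𝓕 h)) {t : ℝ} (ht : 0 < t) :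
    ∫⁻ x, ‖𝓕 (fun ξ => ((t ^ d : ℝ) : ℂ) * h (t⁻¹ • ξ)) x‖ₑ
      = ENNReal.ofReal (t ^ d) * ∫⁻ x, ‖𝓕 h x‖ₑ := by
  have htd : (0 : ℝ) < t ^ d := by positivity
  have h1 : ∀ x, 𝓕 (fun ξ => ((t ^ d : ℝ) : ℂ) * h (t⁻¹ • ξ)) x
      = (((t ^ d * t ^ d : ℝ)) : ℂ) * 𝓕 h (t • x) := by
    intro x
    rw [Real.fourier_eq', Real.fourier_eq']
    have := Measure.integral_comp_smul (volume : Measure (E d))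
      (fun v : E d => Complex.exp (((-2 * Real.pi * ⟪v, t • x⟫ : ℝ) : ℂ) * Complex.I) • h v) t⁻¹
    rw [finrank_euclideanSpace_fin, abs_of_pos (by positivity), inv_pow, inv_inv] at this
    rw [Complex.ofReal_mul, mul_assoc, ← Complex.real_smul (x := t ^ d)
      (z := ∫ v, _), ← this, ← integral_const_mul]
    refine integral_congr_ae (Filter.Eventually.of_forall fun v => ?_)
    have e : ⟪t⁻¹ • v, t • x⟫ = ⟪v, x⟫ := by
      rw [real_inner_smul_left, real_inner_smul_right, ← mul_assoc, inv_mul_cancel₀ ht.ne',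
        one_mul]
    simp only [e, smul_eq_mul]
    ring
  simp_rw [h1, enorm_mul]
  rw [lintegral_const_mul (f := fun x => ‖𝓕 h (t • x)‖ₑ) _
      (hm.enorm.comp (by fun_prop : Measurable fun x : E d => t • x)),
    ← lintegral_map (f := fun y => ‖𝓕 h y‖ₑ) hm.enorm (by fun_prop : Measurable fun x : E d => t • x),
    Measure.map_addHaar_smul _ ht.ne', lintegral_smul_measure, finrank_euclideanSpace_fin,
    abs_of_pos (by positivity), smul_eq_mul, ← mul_assoc]
  congr 1
  rw [← ofReal_norm, Complex.norm_real, Real.norm_of_nonneg (by positivity),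
    ← ENNReal.ofReal_mul (by positivity)]
  congr 1
  field_simp

/-! ### The bound on each dyadic block. -/

lemma eLpNorm_integral_gaussSum_le {k : ℕ} {a : ℕ → ℝ}
    (ha : ∀ F r, dyadicDiff k F r = ∑ i ∈ Finset.range (k + 2), a i * F (r / 2 ^ i))
    {b s : ℝ} (hb : 0 < b) (hs : 0 ≤ s) {p p' : ℝ≥0∞} [ENNReal.HolderConjugate p' p] (q : ℝ≥0∞)
    (μ : Measure (E d)) [IsFiniteMeasure μ] :
    eLpNorm (fun v => ∫ x, gaussSum a (k + 2) (b ^ 2) (x - v) ∂μ) q volume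
      ≤ ENNReal.ofReal (b ^ (-s)) * eLpNorm (holderWeight s) p' radialMeasure
        * eLpNorm (fun y => eLpNorm (fun r => r ^ (-s) * dyadicDiff k (ballMass μ y) r) p
          radialMeasure) q volume := by
  have hW := eLpNorm_holderWeight_lt_top hs p'
  lift eLpNorm (holderWeight s) p' radialMeasure to ℝ≥0 using hW.ne with w hw
  have := eLpNorm_le_nnreal_smul_eLpNorm_of_ae_le_mul' (μ := (volume : Measure (E d)))
    (f := fun v => ∫ x, gaussSum a (k + 2) (b ^ 2) (x - v) ∂μ)
    (g := fun y => eLpNorm (fun r => r ^ (-s) * dyadicDiff k (ballMass μ y) r) p radialMeasure)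
    (c := Real.toNNReal (b ^ (-s)) * w) (Filter.Eventually.of_forall fun v => ?_) q
  · rw [ENNReal.smul_def, ENNReal.coe_mul] at this
    exact this
  · rw [integral_gaussSum_eq ha μ v (by positivity), enorm_eq_self, ENNReal.coe_mul, hw]
    exact enorm_integral_gaussDensity_le (measurable_dyadicDiff (measurable_ballMass μ v) k) hb

lemma dyadicBlock_eq (χ : E d → ℝ) (j : ℤ) (T : 𝓢'(E d, ℂ)) :
    dyadicBlock χ j T = TemperedDistribution.fourierMultiplierCLM ℂ
      (fun ξ => ((annulus χ (((2 : ℝ) ^ j)⁻¹ • ξ) : ℝ) : ℂ)) T := by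
  rw [dyadicBlock]
  congr 1
  simp only [annulus, smul_smul]
  rw [zpow_sub₀ two_ne_zero, zpow_one, zpow_neg, div_eq_mul_inv]

theorem exists_dyadicBlock_le {χ : E d → ℝ} (hχ : IsLPCutoff χ) {α : ℝ} (hα : 0 < α)
    {p q : ℝ≥0∞} (hp : 1 ≤ p) (hq : 1 ≤ q) :
    ∃ C : ℝ≥0, ∀ (μ : Measure (E d)) [IsFiniteMeasure μ] (j : ℤ),
      (2 : ℝ≥0∞) ^ ((j : ℝ) * α) * distLpNorm q (dyadicBlock χ j μ.toTemperedDistribution)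
        ≤ C * sbeNorm α p q μ := by
  set k := ⌈α + (d : ℝ) - 1⌉₊
  obtain ⟨a, -, ha1, ha⟩ := exists_dyadicDiff_eq_sum k
  obtain ⟨b, hb, hG⟩ := exists_gaussSymbol_ne_zero d (k + 1) a ha1
  set s : ℝ := α + d with hs
  have hs0 : 0 ≤ s := by positivity
  let p' := ENNReal.conjExponent p
  have : ENNReal.HolderConjugate p p' := .conjExponent hp
  have : ENNReal.HolderConjugate p' p := .symm
  set h₀ : E d → ℂ := fun ξ => ((annulus χ ξ / gaussSymbol a (k + 2) (b ^ 2) ξ : ℝ) : ℂ) with hh₀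
  have hh : ContDiff ℝ (⊤ : ℕ∞) h₀ := Complex.ofRealCLM.contDiff.comp
    (hχ.contDiff_annulus_div (contDiff_gaussSymbol _ _ _) hG)
  have hz : ∀ ξ, 2 ≤ ‖ξ‖ → h₀ ξ = 0 := fun ξ hξ => by
    simp [hh₀, hχ.annulus_eq_zero_of_ge hξ]
  have hI : ∫⁻ x, ‖𝓕 h₀ x‖ₑ < ∞ :=
    (integrable_fourier hh (hasCompactSupport_of_eq_zero 2 hz)).2
  have hW := eLpNorm_holderWeight_lt_top hs0 p'
  refine ⟨((∫⁻ x, ‖𝓕 h₀ x‖ₑ) * (ENNReal.ofReal (b ^ (-s)) *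
    eLpNorm (holderWeight s) p' radialMeasure)).toNNReal, fun μ _ j => ?_⟩
  rw [ENNReal.coe_toNNReal (ENNReal.mul_lt_top hI (ENNReal.mul_lt_top ENNReal.ofReal_lt_top hW)).ne]
  set t : ℝ := 2 ^ j with ht
  have ht0 : 0 < t := by positivity
  have hsc : ∀ {ξ : E d}, 2 * t ≤ ‖ξ‖ → 2 ≤ ‖t⁻¹ • ξ‖ := fun {ξ} hξ => by
    rw [norm_smul, Real.norm_of_nonneg (by positivity), inv_mul_eq_div, le_div_iff₀ ht0]
    exact hξ
  -- The division made at frequency `1` is dilated to frequency `t`. The factor `t ^ d` makes up for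
  -- the prefactor of the Gaussian symbol, as in `gaussSymbol_dilate`.
  have key := distLpNorm_multiplier_le_gauss hq
    (m := fun ξ => ((annulus χ (t⁻¹ • ξ) : ℝ) : ℂ))
    (h := fun ξ => ((t ^ d : ℝ) : ℂ) * h₀ (t⁻¹ • ξ)) (a := a) (n := k + 2) (c := (b * t) ^ 2)
    (Complex.ofRealCLM.contDiff.comp (hχ.contDiff_annulus.comp (contDiff_id.const_smul _)))
    (hasCompactSupport_of_eq_zero (2 * t) fun ξ hξ => by
      simp [hχ.annulus_eq_zero_of_ge (hsc hξ)])
    (contDiff_const.mul (hh.comp (contDiff_id.const_smul _)))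
    (hasCompactSupport_of_eq_zero (2 * t) fun ξ hξ => by rw [hz _ (hsc hξ), mul_zero])
    (by positivity) (fun ξ => ?_) μ
  · rw [lintegral_enorm_fourier_dilate
      (continuous_fourier hh (hasCompactSupport_of_eq_zero 2 hz)).measurable ht0] at key
    have hA := eLpNorm_integral_gaussSum_le ha (mul_pos hb ht0) hs0 (p := p) (p' := p') q μ
    have hsbe : sbeNorm α p q μ = eLpNorm (fun y => eLpNorm (fun r => r ^ (-s) *
        dyadicDiff k (ballMass μ y) r) p radialMeasure) q volume := by
      rw [sbeNorm, hs, neg_add']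
    rw [← hsbe] at hA
    have h2 : (2 : ℝ≥0∞) ^ ((j : ℝ) * α) = ENNReal.ofReal (t ^ α) := by
      rw [ht, ← Real.rpow_intCast, ← Real.rpow_mul (by norm_num),
        ← ENNReal.ofReal_rpow_of_pos (by norm_num)]
      norm_num
    -- The powers of `t` cancel because `s = α + d`: this is why the bound is uniform in `j`.
    have h3 : t ^ α * (t ^ d * (b * t) ^ (-s)) = b ^ (-s) := by
      rw [Real.mul_rpow hb.le ht0.le, ← Real.rpow_natCast t d]
      calc _ = b ^ (-s) * (t ^ α * t ^ (d : ℝ) * t ^ (-s)) := by ring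
        _ = b ^ (-s) := by
          rw [← Real.rpow_add ht0, ← Real.rpow_add ht0, hs, add_neg_cancel, Real.rpow_zero,
            mul_one]
    rw [dyadicBlock_eq, h2, ← h3, ENNReal.ofReal_mul (by positivity),
      ENNReal.ofReal_mul (by positivity)]
    refine (mul_le_mul_right (key.trans (mul_le_mul_right hA _)) _).trans (le_of_eq ?_)
    ring
  · have hd := gaussSymbol_dilate a (k + 2) (sq_pos_of_pos hb) ht0 ξ
    rw [mul_pow, hh₀, mul_right_comm]
    dsimp only
    rw [← Complex.ofReal_mul, ← Complex.ofReal_mul, hd]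
    congr 1
    -- Where the Gaussian symbol may vanish, the annulus symbol is zero as well.
    rcases lt_or_ge ‖t⁻¹ • ξ‖ (1 / 4) with h | h
    · rw [hχ.annulus_eq_zero_of_le (by linarith), zero_div, mul_zero]
    · rw [mul_div_cancel₀ _ (hG _ h)]

/-! ### The mass is controlled by the `SBE` norm. -/

lemma radialMeasure_Ico_ne_zero {u v : ℝ} (hu : 0 < u) (huv : u < v) :
    radialMeasure (Set.Ico u v) ≠ 0 := by
  have hv : 0 < v := hu.trans huv
  have hsub : Set.Ico u v ⊆ Set.Ioi 0 := fun r hr => hu.trans_le hr.1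
  have h : ∫⁻ _ in Set.Ico u v, ENNReal.ofReal v⁻¹ ≤ radialMeasure (Set.Ico u v) := by
    rw [radialMeasure, withDensity_apply _ measurableSet_Ico,
      Measure.restrict_restrict measurableSet_Ico,
      Set.inter_eq_left.2 hsub]
    exact setLIntegral_mono (by fun_prop) fun r hr =>
      ENNReal.ofReal_le_ofReal (inv_anti₀ (hu.trans_le hr.1) hr.2.le)
  refine (lt_of_lt_of_le ?_ h).ne'
  rw [setLIntegral_const, Real.volume_Ico, ← ENNReal.ofReal_mul (by positivity)]
  exact ENNReal.ofReal_pos.2 (mul_pos (inv_pos.2 hv) (sub_pos.2 huv))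

lemma ballMass_eq_univ {μ : Measure (E d)} [IsFiniteMeasure μ] {z y : E d} {R r : ℝ}
    (hμ : μ (Metric.closedBall z R)ᶜ = 0) (hr : R + ‖z - y‖ ≤ r) :
    ballMass μ y r = μ.real Set.univ := by
  have hsub : {x : E d | ‖x - y‖ ≤ r}ᶜ ⊆ (Metric.closedBall z R)ᶜ := by
    refine Set.compl_subset_compl.2 fun x hx => ?_
    rw [mem_closedBall_iff_norm] at hx
    have := norm_sub_le_norm_sub_add_norm_sub x z y
    exact this.trans (by linarith)
  have h0 : μ {x : E d | ‖x - y‖ ≤ r}ᶜ = 0 := measure_mono_null hsub hμ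
  rw [ballMass, measureReal_def, measureReal_def, measure_of_measure_compl_eq_zero h0]

lemma ballMass_eq_zero {μ : Measure (E d)} {z y : E d} {R r : ℝ}
    (hμ : μ (Metric.closedBall z R)ᶜ = 0) (hr : R + r < ‖z - y‖) : ballMass μ y r = 0 := by
  have hsub : {x : E d | ‖x - y‖ ≤ r} ⊆ (Metric.closedBall z R)ᶜ := fun x hx hxz => by
    rw [mem_closedBall_iff_norm] at hxz
    have hx' : ‖x - y‖ ≤ r := hx
    have := norm_sub_le_norm_sub_add_norm_sub z x y
    rw [norm_sub_rev z x] at this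
    linarith
  rw [ballMass, measureReal_def, measure_mono_null hsub hμ, ENNReal.toReal_zero]

/-- A measure on a ball of radius `R` has mass controlled by its `SBE` norm: at distance comparable
to `R` the iterated difference of the ball mass is the total mass. -/
theorem exists_mass_le_sbeNorm (hd : 1 ≤ d) (α : ℝ) {p q : ℝ≥0∞} (hp : 1 ≤ p) (hq : 1 ≤ q)
    (R : ℝ) :
    ∃ C : ℝ≥0, ∀ (μ : Measure (E d)) [IsFiniteMeasure μ],
      (∃ z, μ (Metric.closedBall z R)ᶜ = 0) → μ Set.univ ≤ C * sbeNorm α p q μ := by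
  set k := ⌈α + (d : ℝ) - 1⌉₊
  obtain ⟨a, ha0, -, ha⟩ := exists_dyadicDiff_eq_sum k
  -- `R` may be any real number; the maximum with `1` gives a positive radius.
  set ρ := max R 1 with hρ
  have hρ0 : 0 < ρ := lt_max_of_lt_right one_pos
  set s : ℝ := -α - d with hs
  let I : Set ℝ := Set.Ico (7 * ρ) (8 * ρ)
  have hI : radialMeasure I ≠ 0 := radialMeasure_Ico_ne_zero (by positivity) (by linarith)
  have hI' : radialMeasure.restrict I ≠ 0 := fun h => hI (by
    rw [← Measure.restrict_apply_univ, h, Measure.coe_zero, Pi.zero_apply])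
  set B : ℝ≥0∞ := volume (Metric.ball (0 : E d) (ρ / 2)) with hB
  have hB0 : B ≠ 0 := (Metric.measure_ball_pos _ _ (by positivity)).ne'
  set m : ℝ := min ((7 * ρ) ^ s) ((8 * ρ) ^ s) with hm
  have hm0 : 0 < m := lt_min (by positivity) (by positivity)
  -- For an infinite exponent `1 / toReal` is `0` and the factor is `1`, as it should be for the
  -- `L^∞` norm of a constant.
  set c : ℝ≥0∞ := ENNReal.ofReal m * radialMeasure I ^ (1 / p.toReal) * B ^ (1 / q.toReal)
    with hc
  have hpos : ∀ {x : ℝ≥0∞} {r : ℝ}, x ≠ 0 → 0 ≤ r → x ^ r ≠ 0 := fun {x r} hx hr h => by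
    rcases ENNReal.rpow_eq_zero_iff.1 h with h | h
    · exact hx h.1
    · exact absurd h.2 (not_lt.2 hr)
  have hc0 : c ≠ 0 := mul_ne_zero (mul_ne_zero (ENNReal.ofReal_pos.2 hm0).ne'
    (hpos hI (by positivity))) (hpos hB0 (by positivity))
  -- The minimum with `1` gives a finite divisor without a proof that `c` is finite.
  have hc1 : min c 1 ≠ 0 := by simp [hc0]
  refine ⟨((min c 1)⁻¹).toNNReal, fun μ _ ⟨z, hz⟩ => ?_⟩
  rw [ENNReal.coe_toNNReal (ENNReal.inv_ne_top.2 hc1), mul_comm, ← div_eq_mul_inv,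
    ENNReal.le_div_iff_mul_le (Or.inl hc1)
      (Or.inl (ne_top_of_le_ne_top ENNReal.one_ne_top (min_le_right _ _)))]
  refine (mul_le_mul_right (min_le_left c 1) _).trans ?_
  have hzρ : μ (Metric.closedBall z ρ)ᶜ = 0 := measure_mono_null
    (Set.compl_subset_compl.2 (Metric.closedBall_subset_closedBall (le_max_left _ _))) hz
  let e : E d := EuclideanSpace.single ⟨0, hd⟩ 1
  have he : ‖e‖ = 1 := by simp [e]
  -- Centres within `ρ/2` of `y₀` lie at distance between `5ρ` and `6ρ` from `z`. For `7ρ ≤ r < 8ρ`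
  -- the ball of radius `r` contains the closed ball of radius `ρ` about `z`, since `ρ + 6ρ ≤ r`,
  -- and the ball of radius `r/2 < 4ρ` misses it.
  let y₀ : E d := z + (11 / 2 * ρ) • e
  let S : Set (E d) := Metric.ball y₀ (ρ / 2)
  have hSB : volume S = B := Measure.addHaar_ball_center _ _ _
  have hS0 : volume.restrict S ≠ 0 := fun h => hB0 (by
    rw [← hSB, ← Measure.restrict_apply_univ, h, Measure.coe_zero, Pi.zero_apply])
  have hdist : ∀ y ∈ S, 5 * ρ < ‖z - y‖ ∧ ‖z - y‖ < 6 * ρ := by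
    intro y hy
    rw [mem_ball_iff_norm] at hy
    have h1 : ‖z - y₀‖ = 11 / 2 * ρ := by
      simp only [y₀, sub_add_cancel_left, norm_neg, norm_smul, he, mul_one]
      exact Real.norm_of_nonneg (by positivity)
    have h2 := norm_sub_le_norm_sub_add_norm_sub z y y₀
    have h3 := norm_sub_le_norm_sub_add_norm_sub z y₀ y
    rw [norm_sub_rev y₀ y] at h3
    constructor <;> linarith
  have hdiff : ∀ y ∈ S, ∀ r ∈ I, dyadicDiff k (ballMass μ y) r = μ.real Set.univ := by
    intro y hy r hr
    obtain ⟨h5, h6⟩ := hdist y hy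
    -- Only the term `i = 0`, with coefficient `a 0 = 1`, survives.
    rw [ha, Finset.sum_range_succ', Finset.sum_eq_zero, zero_add, ha0, one_mul, pow_zero, div_one,
      ballMass_eq_univ hzρ (by linarith [hr.1])]
    intro i _
    rw [ballMass_eq_zero hzρ, mul_zero]
    have h8 : r / 2 ^ (i + 1) ≤ r / 2 := by
      rw [pow_succ]
      have : 0 ≤ r := by linarith [hr.1]
      gcongr
      exact le_mul_of_one_le_left (by norm_num) (one_le_pow₀ (by norm_num))
    linarith [hr.2]
  have hinner : ∀ y ∈ S, ENNReal.ofReal m * μ Set.univ * radialMeasure I ^ (1 / p.toReal)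
      ≤ eLpNorm (fun r => r ^ s * dyadicDiff k (ballMass μ y) r) p radialMeasure := by
    intro y hy
    have e1 : ENNReal.ofReal m * μ Set.univ = ‖m * μ.real Set.univ‖ₑ := by
      rw [Real.enorm_of_nonneg (by positivity), ENNReal.ofReal_mul hm0.le, ofReal_measureReal]
    have e2 := eLpNorm_const (μ := radialMeasure.restrict I) (p := p) (m * μ.real Set.univ)
      (zero_lt_one.trans_le hp).ne' hI'
    rw [Measure.restrict_apply_univ] at e2
    rw [e1, ← e2]
    refine (eLpNorm_mono_ae ?_).trans (eLpNorm_mono_measure _ Measure.restrict_le_self)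
    filter_upwards [ae_restrict_mem measurableSet_Ico] with r hr
    have hr0 : 0 < r := lt_of_lt_of_le (by positivity) hr.1
    rw [hdiff y hy r hr, norm_mul, norm_mul, Real.norm_of_nonneg hm0.le,
      Real.norm_of_nonneg (Real.rpow_nonneg hr0.le s)]
    gcongr
    rcases le_total 0 s with h | h
    · exact (min_le_left _ _).trans (Real.rpow_le_rpow (by positivity) hr.1 h)
    · exact (min_le_right _ _).trans (Real.rpow_le_rpow_of_nonpos hr0 hr.2.le h)
  have houter := eLpNorm_const (μ := volume.restrict S) (p := q)
    (ENNReal.ofReal m * μ Set.univ * radialMeasure I ^ (1 / p.toReal))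
    (zero_lt_one.trans_le hq).ne' hS0
  rw [Measure.restrict_apply_univ, hSB, enorm_eq_self] at houter
  calc μ Set.univ * c = ENNReal.ofReal m * μ Set.univ * radialMeasure I ^ (1 / p.toReal)
        * B ^ (1 / q.toReal) := by rw [hc]; ring
    _ = _ := houter.symm
    _ ≤ _ := (eLpNorm_mono_enorm_ae (by
        filter_upwards [ae_restrict_mem measurableSet_ball] with y hy
        simpa only [enorm_eq_self] using hinner y hy)).trans
          (eLpNorm_mono_measure _ Measure.restrict_le_self)

/-! ### The Besov norms. -/

lemma eLpNorm_top_count_le {ι : Type*} [MeasurableSpace ι] {f : ι → ℝ≥0∞} {M : ℝ≥0∞}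
    (h : ∀ i, f i ≤ M) : eLpNorm f ∞ Measure.count ≤ M := by
  rw [eLpNorm_exponent_top]
  exact essSup_le_of_ae_le _ (Filter.Eventually.of_forall h)

theorem exists_homBesovNorm_le {χ : E d → ℝ} (hχ : IsLPCutoff χ) {α : ℝ} (hα : 0 < α)
    {p q : ℝ≥0∞} (hp : 1 ≤ p) (hq : 1 ≤ q) :
    ∃ C : ℝ≥0, ∀ (μ : Measure (E d)) [IsFiniteMeasure μ],
      homBesovNorm χ α q ∞ μ.toTemperedDistribution ≤ C * sbeNorm α p q μ := by
  obtain ⟨C, hC⟩ := exists_dyadicBlock_le hχ hα hp hq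
  exact ⟨C, fun μ _ => eLpNorm_top_count_le (hC μ)⟩

lemma exists_eLpNorm_fourier_eq {m : E d → ℂ} (hm : ContDiff ℝ (⊤ : ℕ∞) m)
    (hs : HasCompactSupport m) (q : ℝ≥0∞) :
    ∃ L : ℝ≥0, eLpNorm (𝓕 m) q volume = L := by
  obtain ⟨N, hN⟩ := exists_schwartzMap_eq_fourier hm hs
  rw [← hN]
  exact ⟨_, (ENNReal.coe_toNNReal (N.memLp q volume).eLpNorm_ne_top).symm⟩

theorem exists_besovNorm_le (hd : 1 ≤ d) {χ : E d → ℝ} (hχ : IsLPCutoff χ) {α : ℝ} (hα : 0 < α)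
    {p q : ℝ≥0∞} (hp : 1 ≤ p) (hq : 1 ≤ q) (R : ℝ) :
    ∃ C : ℝ≥0, ∀ (μ : Measure (E d)) [IsFiniteMeasure μ],
      (∃ z, μ (Metric.closedBall z R)ᶜ = 0) →
        besovNorm χ α q ∞ μ.toTemperedDistribution ≤ C * sbeNorm α p q μ := by
  obtain ⟨C₁, hC₁⟩ := exists_dyadicBlock_le hχ hα hp hq
  obtain ⟨C₂, hC₂⟩ := exists_mass_le_sbeNorm hd α hp hq R
  set m : E d → ℂ := fun ξ => (χ ξ : ℂ)
  have hm : ContDiff ℝ (⊤ : ℕ∞) m := Complex.ofRealCLM.contDiff.comp hχ.smooth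
  have hs : HasCompactSupport m := hasCompactSupport_of_eq_zero 2 fun ξ hξ => by
    simp [m, hχ.eq_zero ξ hξ]
  obtain ⟨L, hL⟩ := exists_eLpNorm_fourier_eq hm hs q
  refine ⟨max C₁ (L * C₂), fun μ _ hz => eLpNorm_top_count_le fun j => ?_⟩
  -- The low frequency block is bounded through the mass, the others by the homogeneous estimate.
  rcases j with _ | j
  · calc _ ≤ μ Set.univ * L := by
          rw [Nat.cast_zero, zero_mul, ENNReal.rpow_zero, one_mul, ← hL]
          exact distLpNorm_multiplier_le_mass hq hm hs μ
      _ ≤ C₂ * sbeNorm α p q μ * L := by gcongr; exact hC₂ μ hz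
      _ = ((L * C₂ : ℝ≥0) : ℝ≥0∞) * sbeNorm α p q μ := by push_cast; ring
      _ ≤ _ := by gcongr; exact le_max_right _ _
  · have h := hC₁ μ ((j : ℤ) + 1)
    push_cast at h
    calc _ ≤ (C₁ : ℝ≥0∞) * sbeNorm α p q μ := by
          rw [Nat.cast_add_one]; exact h
      _ ≤ _ := by gcongr; exact le_max_left _ _

end SmallBall

theorem theorem2p2 (d : ℕ) (hd : 1 ≤ d) (α : ℝ) (hα : 0 < α) (p q : ℝ≥0∞)
    (hp : 1 ≤ p) (hp_top : p < ∞) (hq : 1 ≤ q) :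
    (∀ (μ : Measure (SmallBall.E d)) [IsFiniteMeasure μ], SmallBall.MemSBE α p q μ →
      SmallBall.MemBesov α q ∞ μ.toTemperedDistribution) ∧
    ∀ χ : SmallBall.E d → ℝ, SmallBall.IsLPCutoff χ →
      (∃ C : ℝ≥0, ∀ (μ : Measure (SmallBall.E d)) [IsFiniteMeasure μ],
        SmallBall.MemSBE α p q μ →
          SmallBall.homBesovNorm χ α q ∞ μ.toTemperedDistribution
            ≤ C * SmallBall.sbeNorm α p q μ) ∧
      (∀ R : ℝ, ∃ C : ℝ≥0, ∀ (μ : Measure (SmallBall.E d)) [IsFiniteMeasure μ],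
        SmallBall.MemSBE α p q μ → (∃ z, μ (Metric.closedBall z R)ᶜ = 0) →
          SmallBall.besovNorm χ α q ∞ μ.toTemperedDistribution
            ≤ C * SmallBall.sbeNorm α p q μ) := by
  refine ⟨fun μ _ hμ χ hχ => ?_, fun χ hχ => ⟨?_, fun R => ?_⟩⟩
  · obtain ⟨⟨K, hK, hμK⟩, hfin⟩ := hμ
    obtain ⟨R, hR⟩ := hK.isBounded.subset_closedBall 0
    obtain ⟨C, hC⟩ := SmallBall.exists_besovNorm_le hd hχ hα hp hq R
    exact (hC μ ⟨0, measure_mono_null (Set.compl_subset_compl.2 hR) hμK⟩).trans_lt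
      (ENNReal.mul_lt_top ENNReal.coe_lt_top hfin)
  · obtain ⟨C, hC⟩ := SmallBall.exists_homBesovNorm_le hχ hα hp hq
    exact ⟨C, fun μ _ _ => hC μ⟩
  · obtain ⟨C, hC⟩ := SmallBall.exists_besovNorm_le hd hχ hα hp hq R
    exact ⟨C, fun μ _ _ hz => hC μ hz⟩
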